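/- Let $G$ be a finite group of order $N$ with identity $e$, and let $\mathcal H_A,\mathcal H_B$ be nonzero finite-dimensional complex Hilbert spaces. For $f\in G$ let $U(f)$ and $V(f)$ be unitary operators on $\mathcal H_A$ and $\mathcal H_B$ such that $\Gamma(f)=U(f)\otimes V(f)$ is a projective unitary representation of $G$ with factor system $\gamma$, that is, $\Gamma(f)\Gamma(g)=\gamma(f,g)\Gamma(fg)$ for all $f,g\in G$, normalized by $\Gamma(e)=I$. Let $D^{(1)},\dots,D^{(\kappa)}$ be a complete list of pairwise inequivalent irreducible projective unitary matrix representations of $G$ with the factor system $\gamma$ and the same normalization, $D^{(\lambda)}$ having dimension $d_\lambda$. For $c:G\to\mathbb C$ put $$\mathcal U=\sum_{f\in G}c(f)\,U(f)\otimes V(f).$$ (a) The following three statements are equivalent. (i) The $N\times N$ matrix $C$ with entries $\langle g|C|f\rangle=\gamma(g,g^{-1}f)\,c(g^{-1}f)$ is unitary. (ii) There are unitary $d_\lambda\times d_\lambda$ matrices $\mathcal R^{(\lambda)}$ ($1\le\lambda\le\kappa$) with $$c(f)=\sum_{\lambda=1}^{\kappa}\frac{d_\lambda}{N}\sum_{j,k=1}^{d_\lambda}\bigl[D^{(\lambda)}_{jk}(f)\bigr]^*\mathcal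 R^{(\lambda)}_{jk}\qquad\text{for all }f\in G.$$ (iii) For all $g\in G$, $\ \sum_{f\in G}\gamma^*(f,g)\,c^*(f)\,c(fg)=\delta(e,g)$, where $\delta(e,g)$ is $1$ if $g=e$ and $0$ otherwise. (b) Each of the statements in (a) implies that $\mathcal U$ is unitary and that the following protocol, all of whose gates are then unitary, carries out $\mathcal U$ deterministically. Alice holds $A$ and an ancilla $a$, Bob holds $B$ and an ancilla $b$; the ancillas have orthonormal bases $\{|f\rangle\}_{f\in G}$ and start in the state $N^{-1/2}\sum_f|f\rangle_a|f\rangle_b$. Alice applies $\sum_f|f\rangle\langle f|_a\otimes U(f)$, then a unitary $F$ on $a$ all of whose entries have modulus $N^{-1/2}$, and measures $a$ in the basis $\{|h\rangle\}$. Told the outcome $h$, Bob applies on $b$ the diagonal gate $Z(h)|f\rangle=z\,\langle h|F|f\rangle^{-1}|f\rangle$, where $z$ is a constant of modulus $N^{-1/2}$; then $\sum_f|f\rangle\langle f|_b\otimes V(f)$; then $C$ on $b$; then $\sum_g|g\rangle\langle g|_b\otimes V(g)^\dagger$; and he measures $b$ in the basis $\{|g\rangle\}$. Told the outcome $g$,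 Alice applies $U(g)^\dagger$ on $A$. This holds for every such $F$ and $z$. Here "carries out $\mathcal U$ deterministically" means that there are scalars $s_{h,g}$ with $\sum_{h,g}|s_{h,g}|^2=1$ such that, for every pair of outcomes $(h,g)$ and every input state $|\psi\rangle$ of $AB$, the final unnormalized state is $s_{h,g}\,|h\rangle_a|g\rangle_b\otimes\mathcal U|\psi\rangle$. (c) If $\mathcal U$ is unitary and the operators $U(f)\otimes V(f)$, $f\in G$, are linearly independent, then all three statements in (a) hold. (d) If $\mathcal U$ is unitary and the operators $U(f)\otimes V(f)$, $f\in G$, are linearly dependent, then the coefficients $c(f)$ are not uniquely determined by $\mathcal U$, and there is at least one choice of coefficients $c'(f)$ with $\sum_f c'(f)\,U(f)\otimes V(f)=\mathcal U$ for which all three statements in (a) hold. -/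

import Mathlib

open scoped Kronecker Matrix

noncomputable section

/-- A finite-dimensional projective unitary representation of `G`, in matrix form, with factor
system `γ`, normalized so that the identity is represented by the identity matrix. -/
structure IsProjUnitaryRep {G : Type*} [Group G] {n : Type*} [Fintype n] [DecidableEq n]
    (γ : G → G → ℂ) (Γ : G → Matrix n n ℂ) : Prop where
  unitary : ∀ f, Γ f ∈ Matrix.unitaryGroup n ℂ
  mul : ∀ f g, Γ f * Γ g = γ f g • Γ (f * g)
  one : Γ 1 = 1

/-- A family of matrices is irreducible: the space is nonzero and the only subspaces invariant
under all the matrices are zero and the whole space. -/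
def IsIrredFamily {G : Type*} {n : Type*} [Fintype n] (E : G → Matrix n n ℂ) : Prop :=
  Nonempty n ∧
    ∀ S : Submodule ℂ (n → ℂ), (∀ f, ∀ v ∈ S, E f *ᵥ v ∈ S) → S = ⊥ ∨ S = ⊤

/-- Two families of matrices are equivalent: an invertible matrix intertwines them. -/
def AreEquivalent {G : Type*} {m n : Type*} [Fintype m] [DecidableEq m] [Fintype n]
    [DecidableEq n] (D : G → Matrix m m ℂ) (E : G → Matrix n n ℂ) : Prop :=
  ∃ (T : Matrix m n ℂ) (S : Matrix n m ℂ), T * S = 1 ∧ S * T = 1 ∧ ∀ f, T * E f = D f * T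

/-- `D 0, …, D (κ - 1)` is a complete list, without repetition up to equivalence, of the
irreducible projective unitary representations of `G` with factor system `γ`. -/
structure IsCompleteIrreps {G : Type*} [Group G] (γ : G → G → ℂ) {κ : ℕ} (d : Fin κ → ℕ)
    (D : (l : Fin κ) → G → Matrix (Fin (d l)) (Fin (d l)) ℂ) : Prop where
  rep : ∀ l, IsProjUnitaryRep γ (D l)
  irreducible : ∀ l, IsIrredFamily (D l)
  inequivalent : ∀ l l', l ≠ l' → ¬ AreEquivalent (D l) (D l')
  complete : ∀ (k : ℕ) (E : G → Matrix (Fin k) (Fin k) ℂ),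
    IsProjUnitaryRep γ E → IsIrredFamily E → ∃ l, AreEquivalent (D l) E

/-- The operator `∑ f, c f • U f ⊗ V f` on the tensor product of the two systems. -/
def doubleUnitary {G A B : Type*} [Fintype G] (c : G → ℂ) (U : G → Matrix A A ℂ)
    (V : G → Matrix B B ℂ) : Matrix (A × B) (A × B) ℂ :=
  ∑ f, c f • (U f ⊗ₖ V f)

/-- The group-circulant matrix attached to `c`, twisted by the factor system. -/
def groupCirculant {G : Type*} [Group G] (γ : G → G → ℂ) (c : G → ℂ) : Matrix G G ℂ :=
  Matrix.of fun g f => γ g (g⁻¹ * f) * c (g⁻¹ * f)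

/-- `c` is the inverse group Fourier transform of a collection of unitary matrices, one for each
irreducible representation. -/
def IsFourierOfUnitaries {G : Type*} [Fintype G] {κ : ℕ} (d : Fin κ → ℕ)
    (D : (l : Fin κ) → G → Matrix (Fin (d l)) (Fin (d l)) ℂ) (c : G → ℂ) : Prop :=
  ∃ R : (l : Fin κ) → Matrix (Fin (d l)) (Fin (d l)) ℂ,
    (∀ l, R l ∈ Matrix.unitaryGroup (Fin (d l)) ℂ) ∧
    ∀ f, c f = ∑ l, ((d l : ℂ) / (Fintype.card G : ℂ)) *
      ∑ j, ∑ k, star (D l f j k) * R l j k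

/-- The twisted orthonormality relations for the coefficients `c`. -/
def SatisfiesOrthogonality {G : Type*} [Group G] [Fintype G] [DecidableEq G]
    (γ : G → G → ℂ) (c : G → ℂ) : Prop :=
  ∀ g, ∑ f, star (γ f g) * star (c f) * c (f * g) = if g = 1 then 1 else 0

/-- `F` is unitary and its rows are unbiased to the standard basis. -/
def IsUnbiased {G : Type*} [Fintype G] [DecidableEq G] (F : Matrix G G ℂ) : Prop :=
  F ∈ Matrix.unitaryGroup G ℂ ∧ ∀ h f, ‖F h f‖ = (Real.sqrt (Fintype.card G))⁻¹

/-- The diagonal gate `Z(h)` with `Z(h)|f⟩ = z ⟨h|F|f⟩⁻¹ |f⟩`. -/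
def phaseGate {G : Type*} [DecidableEq G] (F : Matrix G G ℂ) (z : ℂ) (h : G) : Matrix G G ℂ :=
  Matrix.diagonal fun f => z * (F h f)⁻¹

/-- The controlled gate `∑ f, |f⟩⟨f| ⊗ W(f)`. -/
def controlled {G n : Type*} [Fintype G] [DecidableEq G] (W : G → Matrix n n ℂ) :
    Matrix (G × n) (G × n) ℂ :=
  ∑ f, Matrix.single f f (1 : ℂ) ⊗ₖ W f

/-- The gates of the protocol: Alice holds an ancilla `a` (standard basis `G`) and the system `A`,
Bob holds an ancilla `b` (standard basis `G`) and the system `B`. -/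
structure Gates (G A B : Type*) where
  U : G → Matrix A A ℂ
  V : G → Matrix B B ℂ
  F : Matrix G G ℂ
  Z : G → Matrix G G ℂ
  C : Matrix G G ℂ

namespace Gates

variable {G A B : Type*} [Fintype G] [DecidableEq G] [Fintype A] [DecidableEq A]
  [Fintype B] [DecidableEq B]

/-- An operator of Alice on `a` and `A`, acting on the whole system. -/
def alice (X : Matrix (G × A) (G × A) ℂ) :
    Matrix ((G × A) × (G × B)) ((G × A) × (G × B)) ℂ :=
  X ⊗ₖ (1 : Matrix (G × B) (G × B) ℂ)

/-- An operator of Bob on `b` and `B`, acting on the whole system. -/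
def bob (Y : Matrix (G × B) (G × B) ℂ) :
    Matrix ((G × A) × (G × B)) ((G × A) × (G × B)) ℂ :=
  (1 : Matrix (G × A) (G × A) ℂ) ⊗ₖ Y

/-- The product of the maximally entangled state `|G|^(-1/2) ∑ f, |f⟩|f⟩` of `a` and `b` with the
state `ψ` of `A` and `B`. -/
def initialState (ψ : A × B → ℂ) : (G × A) × (G × B) → ℂ := fun x =>
  if x.1.1 = x.2.1 then (((Real.sqrt (Fintype.card G))⁻¹ : ℝ) : ℂ) * ψ (x.1.2, x.2.2) else 0

/-- The product of the state `|h⟩` of `a`, the state `|g⟩` of `b`, and the state `φ` of `A` and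
`B`. -/
def outputState (h g : G) (φ : A × B → ℂ) : (G × A) × (G × B) → ℂ := fun x =>
  if x.1.1 = h ∧ x.2.1 = g then φ (x.1.2, x.2.2) else 0

/-- Alice applies the controlled `U` gate and then `F` on `a`, and measures `a` in the standard
basis; this is the (unnormalized) state for the outcome `h`. -/
def afterAlice (P : Gates G A B) (h : G) (ψ : A × B → ℂ) : (G × A) × (G × B) → ℂ :=
  alice (Matrix.single h h (1 : ℂ) ⊗ₖ (1 : Matrix A A ℂ)) *ᵥ
    (alice (P.F ⊗ₖ (1 : Matrix A A ℂ)) *ᵥ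
      (alice (controlled P.U) *ᵥ initialState ψ))

/-- Told `h`, Bob applies `Z(h)` on `b`, then the controlled `V` gate, then `C` on `b`, then the
controlled `V†` gate, and measures `b` in the standard basis with outcome `g`. -/
def afterBob (P : Gates G A B) (h g : G) (ψ : A × B → ℂ) : (G × A) × (G × B) → ℂ :=
  bob (Matrix.single g g (1 : ℂ) ⊗ₖ (1 : Matrix B B ℂ)) *ᵥ
    (bob (controlled fun f => (P.V f)ᴴ) *ᵥ
      (bob (P.C ⊗ₖ (1 : Matrix B B ℂ)) *ᵥ
        (bob (controlled P.V) *ᵥ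
          (bob (P.Z h ⊗ₖ (1 : Matrix B B ℂ)) *ᵥ P.afterAlice h ψ))))

/-- Told `g`, Alice applies `U(g)†` on `A`: the final (unnormalized) state for the measurement
outcomes `h` and `g`; its squared norm is the probability of this pair of outcomes. -/
def finalState (P : Gates G A B) (h g : G) (ψ : A × B → ℂ) : (G × A) × (G × B) → ℂ :=
  alice ((1 : Matrix G G ℂ) ⊗ₖ (P.U g)ᴴ) *ᵥ P.afterBob h g ψ

/-- All the gates are unitary. -/
def AreUnitary (P : Gates G A B) : Prop :=
  (∀ f, P.U f ∈ Matrix.unitaryGroup A ℂ) ∧ (∀ f, P.V f ∈ Matrix.unitaryGroup B ℂ) ∧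
  P.F ∈ Matrix.unitaryGroup G ℂ ∧ (∀ h, P.Z h ∈ Matrix.unitaryGroup G ℂ) ∧
  P.C ∈ Matrix.unitaryGroup G ℂ

/-- The protocol carries out `Q` deterministically: its gates are unitary, and for every pair of
measurement outcomes, of probability `‖s h g‖ ^ 2` independent of the input, the input `ψ` is
transformed into `Q ψ` up to the scalar `s h g`. -/
def CarriesOut (P : Gates G A B) (Q : Matrix (A × B) (A × B) ℂ) : Prop :=
  P.AreUnitary ∧ ∃ s : G → G → ℂ, ∑ h, ∑ g, ‖s h g‖ ^ 2 = 1 ∧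
    ∀ (h g : G) (ψ : A × B → ℂ), P.finalState h g ψ = s h g • outputState h g (Q *ᵥ ψ)

end Gates

end

/-! Functions on `G` form the group algebra twisted by `γ`, a finite-dimensional *-algebra, and
`twistedSum E` is the *-representation extending a projective representation `E`. The sums in (iii)
are the coefficients of `c* c`, so (iii) says that `c` is a unitary element.

The twisted regular representation is faithful and sends `c` to the matrix of (i); hence (i) ↔
(iii). By Maschke's argument the irreducible representations are jointly faithful, and by Schur
orthogonality the Fourier formula in (ii) inverts `c ↦ (D l (c))`; so (ii) says that every `D l (c)`
is unitary, which is again (iii).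

Unitarity in (b) follows by applying `twistedSum` of `U f ⊗ V f`, and (c) holds because independence
makes this map injective. For (d), its kernel is generated by a central projection `p`, and `(1 -
p)c + p` is a unitary element with the same image as `c`. The protocol works because row `g` of `C`,
followed by `(U g ⊗ V g)†`, reproduces the whole sum for every `g`. -/

open scoped Kronecker Matrix

noncomputable section

/-! ### The twisted group algebra and its representations -/

/-- The operator `∑ f, a f • E f` attached to coefficients `a` and a family of matrices `E`. -/
def twistedSum {G n : Type*} [Fintype G] (E : G → Matrix n n ℂ) :
    (G → ℂ) →ₗ[ℂ] Matrix n n ℂ :=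
  ∑ f, (LinearMap.proj f : (G → ℂ) →ₗ[ℂ] ℂ).smulRight (E f)

theorem twistedSum_apply {G n : Type*} [Fintype G] (E : G → Matrix n n ℂ) (a : G → ℂ) :
    twistedSum E a = ∑ f, a f • E f := by
  simp [twistedSum, LinearMap.sum_apply]

/-- The product of the twisted group algebra. -/
def twistedConv {G : Type*} [Group G] [Fintype G] (γ : G → G → ℂ) (a b : G → ℂ) : G → ℂ :=
  fun g => ∑ f, γ f (f⁻¹ * g) * a f * b (f⁻¹ * g)

/-- The involution of the twisted group algebra. -/
def twistedStar {G : Type*} [Group G] (γ : G → G → ℂ) (a : G → ℂ) : G → ℂ :=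
  fun g => star (γ g⁻¹ g * a g⁻¹)

/-- The function whose values at `g` appear in the twisted orthonormality relations. -/
def autocorrelation {G : Type*} [Group G] [Fintype G] (γ : G → G → ℂ) (c : G → ℂ) : G → ℂ :=
  fun g => ∑ f, star (γ f g) * star (c f) * c (f * g)

/-- The right regular representation twisted by `γ`. -/
def regularRep {G : Type*} [Group G] [DecidableEq G] (γ : G → G → ℂ) (k : G) : Matrix G G ℂ :=
  Matrix.of fun g f => if g⁻¹ * f = k then γ g k else 0

theorem satisfiesOrthogonality_iff {G : Type*} [Group G] [Fintype G] [DecidableEq G]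
    (γ : G → G → ℂ) (c : G → ℂ) :
    SatisfiesOrthogonality γ c ↔ autocorrelation γ c = Pi.single 1 1 := by
  simp only [SatisfiesOrthogonality, funext_iff, autocorrelation, Pi.single_apply]

theorem doubleUnitary_eq_twistedSum {G A B : Type*} [Fintype G] (c : G → ℂ)
    (U : G → Matrix A A ℂ) (V : G → Matrix B B ℂ) :
    doubleUnitary c U V = twistedSum (fun f => U f ⊗ₖ V f) c := by
  rw [twistedSum_apply]; rfl

theorem groupCirculant_eq_twistedSum {G : Type*} [Group G] [Fintype G] [DecidableEq G]
    (γ : G → G → ℂ) (c : G → ℂ) :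
    groupCirculant γ c = twistedSum (regularRep γ) c := by
  ext g f
  simp [groupCirculant, twistedSum_apply, Matrix.sum_apply, regularRep, mul_comm]

theorem twistedSum_intertwines {G m n : Type*} [Fintype G] [Fintype m] [Fintype n]
    {D : G → Matrix m m ℂ} {E : G → Matrix n n ℂ} {W : Matrix n m ℂ}
    (h : ∀ f, E f * W = W * D f) {a : G → ℂ} : twistedSum E a * W = W * twistedSum D a := by
  simp [twistedSum_apply, Matrix.sum_mul, Matrix.mul_sum, h]

/-- A normalized factor system with values of modulus one. -/
structure IsUnitaryFactorSystem {G : Type*} [Group G] (γ : G → G → ℂ) : Prop where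
  star_mul : ∀ f g, star (γ f g) * γ f g = 1
  one_left : ∀ g, γ 1 g = 1
  one_right : ∀ g, γ g 1 = 1
  assoc : ∀ f g h, γ f g * γ (f * g) h = γ f (g * h) * γ g h

namespace IsProjUnitaryRep

variable {G n : Type*} [Group G] [Fintype n] [DecidableEq n]
  {γ : G → G → ℂ} {E : G → Matrix n n ℂ}

theorem conjTranspose_mul_self (hE : IsProjUnitaryRep γ E) (f : G) : (E f)ᴴ * E f = 1 :=
  Matrix.mem_unitaryGroup_iff'.1 (hE.unitary f)

theorem self_mul_conjTranspose (hE : IsProjUnitaryRep γ E) (f : G) : E f * (E f)ᴴ = 1 :=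
  Matrix.mem_unitaryGroup_iff.1 (hE.unitary f)

/-- Lets scalar identities for `γ` be read off from operator identities; on the zero space they
would be lost. -/
theorem smul_left_injective [Nonempty n] (hE : IsProjUnitaryRep γ E) (f : G) :
    Function.Injective fun x : ℂ => x • E f := by
  intro x y h
  have h' : (x • (1 : Matrix n n ℂ)) = y • 1 := by
    have := congrArg (· * (E f)ᴴ) h
    simpa [hE.self_mul_conjTranspose] using this
  inhabit n
  simpa using congrFun (congrFun h' default) default

theorem isUnitaryFactorSystem [Nonempty n] (hE : IsProjUnitaryRep γ E) :
    IsUnitaryFactorSystem γ where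
  star_mul f g := by
    apply hE.smul_left_injective 1
    have h : (E f * E g)ᴴ * (E f * E g) = 1 := by
      rw [Matrix.conjTranspose_mul, Matrix.mul_assoc, ← Matrix.mul_assoc _ (E f),
        hE.conjTranspose_mul_self, Matrix.one_mul, hE.conjTranspose_mul_self]
    rw [hE.mul, Matrix.conjTranspose_smul, Matrix.smul_mul, Matrix.mul_smul, smul_smul,
      hE.conjTranspose_mul_self] at h
    simp only [hE.one, one_smul, h]
  one_left g := by
    apply hE.smul_left_injective g
    have := hE.mul 1 g
    simp only [hE.one, one_mul] at this
    simp [← this]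
  one_right g := by
    apply hE.smul_left_injective g
    have := hE.mul g 1
    simp only [hE.one, mul_one] at this
    simp [← this]
  assoc f g h := by
    apply hE.smul_left_injective (f * g * h)
    have := Matrix.mul_assoc (E f) (E g) (E h)
    rw [hE.mul, hE.mul, Matrix.smul_mul, Matrix.mul_smul, hE.mul, hE.mul, smul_smul, smul_smul,
      ← mul_assoc f] at this
    simp only [this, mul_comm (γ f (g * h))]

variable (hγ : IsUnitaryFactorSystem γ)
include hγ

theorem conjTranspose_mul (hE : IsProjUnitaryRep γ E) (f g : G) :
    (E f)ᴴ * E (f * g) = star (γ f g) • E g := by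
  have : E (f * g) = star (γ f g) • (E f * E g) := by
    rw [hE.mul, smul_smul, hγ.star_mul, one_smul]
  rw [this, Matrix.mul_smul, ← Matrix.mul_assoc, hE.conjTranspose_mul_self, Matrix.one_mul]

theorem conjTranspose_eq (hE : IsProjUnitaryRep γ E) (f : G) :
    (E f)ᴴ = star (γ f f⁻¹) • E f⁻¹ := by
  rw [← hE.conjTranspose_mul hγ, mul_inv_cancel, hE.one, Matrix.mul_one]

omit hγ
variable [Fintype G]

theorem twistedSum_single [DecidableEq G] (hE : IsProjUnitaryRep γ E) :
    twistedSum E (Pi.single 1 1) = 1 := by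
  rw [twistedSum_apply, Finset.sum_eq_single 1] <;> simp +contextual [hE.one]

theorem twistedSum_conv (hE : IsProjUnitaryRep γ E) (a b : G → ℂ) :
    twistedSum E (twistedConv γ a b) = twistedSum E a * twistedSum E b := by
  simp only [twistedSum_apply, twistedConv, Finset.sum_smul]
  rw [Finset.sum_comm, Finset.sum_mul]
  refine Finset.sum_congr rfl fun f _ => ?_
  rw [Finset.mul_sum]
  refine (Fintype.sum_equiv (Equiv.mulLeft f) _ _ fun g => ?_).symm
  simp only [Equiv.coe_mulLeft, inv_mul_cancel_left, Matrix.smul_mul, Matrix.mul_smul, hE.mul,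
    smul_smul]
  congr 1; ring

include hγ

theorem twistedSum_star (hE : IsProjUnitaryRep γ E) (a : G → ℂ) :
    twistedSum E (twistedStar γ a) = (twistedSum E a)ᴴ := by
  simp only [twistedSum_apply, twistedStar, Matrix.conjTranspose_sum, Matrix.conjTranspose_smul]
  refine Fintype.sum_equiv (Equiv.inv G) _ _ fun g => ?_
  simp only [Equiv.inv_apply, hE.conjTranspose_eq hγ, smul_smul, inv_inv, star_mul']
  congr 1; ring

/-- Since `(E f)ᴴ * E (f * g)` is `star (γ f g) • E g`, collecting the terms of `(∑ c f E f)ᴴ (∑ c k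
E k)` with `k = f * g` gives the sum in (iii). -/
theorem twistedSum_autocorrelation (hE : IsProjUnitaryRep γ E) (c : G → ℂ) :
    twistedSum E (autocorrelation γ c) = (twistedSum E c)ᴴ * twistedSum E c := by
  simp only [twistedSum_apply, autocorrelation, Matrix.conjTranspose_sum,
    Matrix.conjTranspose_smul, Finset.sum_smul]
  rw [Finset.sum_comm, Finset.sum_mul]
  refine Finset.sum_congr rfl fun f _ => ?_
  rw [Finset.mul_sum]
  refine Fintype.sum_equiv (Equiv.mulLeft f) _ _ fun g => ?_
  simp only [Equiv.coe_mulLeft, Matrix.smul_mul, Matrix.mul_smul, hE.conjTranspose_mul hγ,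
    smul_smul]
  congr 1; ring

theorem twistedSum_mem_unitaryGroup_iff [DecidableEq G] (hE : IsProjUnitaryRep γ E)
    (c : G → ℂ) : twistedSum E c ∈ Matrix.unitaryGroup n ℂ ↔
      twistedSum E (autocorrelation γ c) = twistedSum E (Pi.single 1 1) := by
  rw [Matrix.mem_unitaryGroup_iff', hE.twistedSum_autocorrelation hγ, hE.twistedSum_single]
  rfl

end IsProjUnitaryRep

/-! ### The twisted regular representation -/

namespace IsUnitaryFactorSystem

variable {G : Type*} [Group G] [Fintype G] [DecidableEq G] {γ : G → G → ℂ}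

theorem regularRep_isProjUnitaryRep (hγ : IsUnitaryFactorSystem γ) :
    IsProjUnitaryRep γ (regularRep γ) where
  unitary k := by
    rw [Matrix.mem_unitaryGroup_iff]
    ext g f
    simp only [Matrix.mul_apply, regularRep, Matrix.star_apply, Matrix.of_apply, Matrix.one_apply]
    rw [Finset.sum_eq_single (g * k)]
    · by_cases h : g = f
      · subst h; simp [mul_comm, ← hγ.star_mul g k]
      · have : f⁻¹ * (g * k) ≠ k := by
          rw [← mul_assoc, Ne, mul_eq_right, inv_mul_eq_one]; exact fun h' => h h'.symm
        simp [h, this]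
    · intro b _ hb
      have : g⁻¹ * b ≠ k := by rwa [Ne, inv_mul_eq_iff_eq_mul]
      simp [this]
    · simp
  mul k l := by
    ext g f
    simp only [Matrix.mul_apply, regularRep, Matrix.of_apply, Matrix.smul_apply]
    rw [Finset.sum_eq_single (g * k)]
    · have : (g * k)⁻¹ * f = l ↔ g⁻¹ * f = k * l := by
        rw [inv_mul_eq_iff_eq_mul, inv_mul_eq_iff_eq_mul, mul_assoc]
      by_cases h : g⁻¹ * f = k * l
      · simp [-mul_inv_rev, h, this, hγ.assoc, mul_comm]
      · simp [-mul_inv_rev, h, this]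
    · intro b _ hb
      have : g⁻¹ * b ≠ k := by rwa [Ne, inv_mul_eq_iff_eq_mul]
      simp [this]
    · simp
  one := by
    ext g f
    simp [regularRep, Matrix.one_apply, inv_mul_eq_one, hγ.one_right]

/-- The row of the identity element in the circulant matrix is the coefficient function itself. -/
theorem twistedSum_regularRep_injective (hγ : IsUnitaryFactorSystem γ) :
    Function.Injective (twistedSum (regularRep γ)) := by
  intro a b h
  ext k
  rw [← groupCirculant_eq_twistedSum, ← groupCirculant_eq_twistedSum] at h
  simpa [groupCirculant, hγ.one_left] using congrFun (congrFun h 1) k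

theorem groupCirculant_mem_unitaryGroup_iff (hγ : IsUnitaryFactorSystem γ) (c : G → ℂ) :
    groupCirculant γ c ∈ Matrix.unitaryGroup G ℂ ↔ SatisfiesOrthogonality γ c := by
  rw [groupCirculant_eq_twistedSum,
    hγ.regularRep_isProjUnitaryRep.twistedSum_mem_unitaryGroup_iff hγ,
    hγ.twistedSum_regularRep_injective.eq_iff, satisfiesOrthogonality_iff]

end IsUnitaryFactorSystem

/-! ### Complete reducibility and joint faithfulness of the irreducibles -/

/-- Every subspace has an orthonormal basis, written as the columns of a matrix. -/
theorem exists_isometries_of_submodule {n : Type*} [Fintype n] [DecidableEq n]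
    (S : Submodule ℂ (n → ℂ)) :
    ∃ (k : ℕ) (W : Matrix n (Fin k) ℂ), Wᴴ * W = 1 ∧ ∀ v, v ∈ S ↔ W *ᵥ (Wᴴ *ᵥ v) = v := by
  let S' : Submodule ℂ (EuclideanSpace ℂ n) :=
    S.comap (WithLp.linearEquiv 2 ℂ (n → ℂ)).toLinearMap
  let b := stdOrthonormalBasis ℂ S'
  let W : Matrix n (Fin (Module.finrank ℂ S')) ℂ := Matrix.of fun i j => (b j : EuclideanSpace ℂ n) i
  have hmem (w) : W *ᵥ w ∈ S := by
    have : W *ᵥ w = ∑ j, w j • ((b j : EuclideanSpace ℂ n) : n → ℂ) := by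
      ext i
      simp [W, Matrix.mulVec, dotProduct, mul_comm]
    rw [this]
    exact S.sum_mem fun j _ => S.smul_mem _ (b j).2
  refine ⟨_, W, ?_, fun v => ⟨fun hv => ?_, fun hv => hv ▸ hmem _⟩⟩
  · ext i j
    have := orthonormal_iff_ite.1 b.orthonormal i j
    rw [Submodule.coe_inner, PiLp.inner_apply] at this
    simpa [W, Matrix.mul_apply, Matrix.one_apply, mul_comm] using this
  · have := b.sum_repr ⟨WithLp.toLp 2 v, hv⟩
    have := congrArg Subtype.val this
    ext i
    have := congrArg (fun x : EuclideanSpace ℂ n => x i) this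
    simp [b.repr_apply_apply, PiLp.inner_apply] at this
    rw [← this]
    simp [W, Matrix.mulVec, dotProduct, mul_comm]

/-- The columns of the two matrices are orthonormal bases of a subspace and of its orthogonal
complement. -/
theorem exists_complementary_isometries {n : Type*} [Fintype n] [DecidableEq n]
    (S : Submodule ℂ (n → ℂ)) :
    ∃ (k l : ℕ) (W : Matrix n (Fin k) ℂ) (X : Matrix n (Fin l) ℂ), Wᴴ * W = 1 ∧ Xᴴ * X = 1 ∧
      W * Wᴴ + X * Xᴴ = 1 ∧ ∀ v, v ∈ S ↔ W *ᵥ (Wᴴ *ᵥ v) = v := by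
  obtain ⟨k, W, hW, hS⟩ := exists_isometries_of_submodule S
  obtain ⟨l, X, hX, hT⟩ := exists_isometries_of_submodule (LinearMap.ker Wᴴ.mulVecLin)
  refine ⟨k, l, W, X, hW, hX, ?_, hS⟩
  have h0 : X * Xᴴ * (1 - W * Wᴴ) = 1 - W * Wᴴ := by
    refine Matrix.ext_of_mulVec_single fun i => ?_
    rw [← Matrix.mulVec_mulVec, ← Matrix.mulVec_mulVec]
    refine (hT _).1 ?_
    rw [LinearMap.mem_ker, Matrix.mulVecLin_apply, Matrix.mulVec_mulVec, Matrix.mul_sub,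
      ← Matrix.mul_assoc, hW, Matrix.mul_one, Matrix.one_mul, sub_self, Matrix.zero_mulVec]
  have h1 : Wᴴ * X = 0 := by
    refine Matrix.ext_of_mulVec_single fun i => ?_
    rw [← Matrix.mulVec_mulVec, Matrix.zero_mulVec]
    have := (hT (X *ᵥ Pi.single i 1)).2 (by
      rw [Matrix.mulVec_mulVec _ Xᴴ, hX, Matrix.one_mulVec])
    simpa using this
  have h2 : Xᴴ * W = 0 := by simpa using congrArg Matrix.conjTranspose h1
  rw [Matrix.mul_sub, Matrix.mul_one, Matrix.mul_assoc, ← Matrix.mul_assoc Xᴴ, h2,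
    Matrix.zero_mul, Matrix.mul_zero, sub_zero] at h0
  rw [h0]; abel

namespace IsProjUnitaryRep

variable {G n : Type*} [Group G] [Fintype n] [DecidableEq n]
  {γ : G → G → ℂ} {E : G → Matrix n n ℂ}

/-- The hypothesis `h` says that the range of the isometry `W` is invariant; the compression is the
subrepresentation on it. -/
theorem compress (hE : IsProjUnitaryRep γ E) {k : ℕ} {W : Matrix n (Fin k) ℂ} (hW : Wᴴ * W = 1)
    (h : ∀ f, E f * W = W * (Wᴴ * E f * W)) : IsProjUnitaryRep γ fun f => Wᴴ * E f * W where
  unitary f := by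
    rw [Matrix.mem_unitaryGroup_iff', Matrix.star_eq_conjTranspose]
    calc (Wᴴ * E f * W)ᴴ * (Wᴴ * E f * W) = Wᴴ * (E f)ᴴ * (W * (Wᴴ * E f * W)) := by
          simp [Matrix.mul_assoc]
      _ = Wᴴ * ((E f)ᴴ * E f) * W := by rw [← h]; simp only [Matrix.mul_assoc]
      _ = 1 := by rw [hE.conjTranspose_mul_self, Matrix.mul_one, hW]
  mul f g := by
    calc Wᴴ * E f * W * (Wᴴ * E g * W) = Wᴴ * E f * (W * (Wᴴ * E g * W)) := by
          simp only [Matrix.mul_assoc]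
      _ = Wᴴ * (E f * E g) * W := by rw [← h]; simp only [Matrix.mul_assoc]
      _ = _ := by rw [hE.mul]; simp
  one := by rw [hE.one, Matrix.mul_one, hW]

variable [Fintype G]

/-- Maschke's argument by induction on the dimension: a reducible representation splits into an
invariant subspace and its invariant orthogonal complement, and `a` acts as zero on both. -/
theorem twistedSum_eq_zero_of_dim {κ : ℕ} {d : Fin κ → ℕ}
    {D : (l : Fin κ) → G → Matrix (Fin (d l)) (Fin (d l)) ℂ} (hD : IsCompleteIrreps γ d D)
    (hγ : IsUnitaryFactorSystem γ) {a : G → ℂ} (ha : ∀ l, twistedSum (D l) a = 0) (k : ℕ) :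
    ∀ E : G → Matrix (Fin k) (Fin k) ℂ, IsProjUnitaryRep γ E → twistedSum E a = 0 := by
  induction k using Nat.strong_induction_on with
  | _ k ih =>
  intro E hE
  by_cases hirr : IsIrredFamily E
  · obtain ⟨l, T, S, -, hST, hT⟩ := hD.complete k E hE hirr
    have := twistedSum_intertwines (fun f => (hT f).symm) (a := a)
    rw [ha, Matrix.zero_mul] at this
    rw [← Matrix.one_mul (twistedSum E a), ← hST, Matrix.mul_assoc, ← this, Matrix.mul_zero]
  rcases isEmpty_or_nonempty (Fin k) with hk | hk
  · exact Subsingleton.elim _ _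
  simp only [IsIrredFamily, hk, true_and, not_forall, not_or] at hirr
  obtain ⟨S, hS, hbot, htop⟩ := hirr
  obtain ⟨p, q, W, X, hW, hX, hWX, hmem⟩ := exists_complementary_isometries S
  have hW' (f) : E f * W = W * (Wᴴ * E f * W) := by
    refine Matrix.ext_of_mulVec_single fun i => ?_
    have h1 : W *ᵥ Pi.single i 1 ∈ S := by
      rw [hmem, Matrix.mulVec_mulVec _ Wᴴ, hW, Matrix.one_mulVec]
    have := (hmem _).1 (hS f _ h1)
    rw [← Matrix.mulVec_mulVec, ← this]
    simp only [Matrix.mulVec_mulVec, Matrix.mul_assoc]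
  have hX1 : X * Xᴴ = 1 - W * Wᴴ := eq_sub_of_add_eq' hWX
  have hXW : Xᴴ * W = 0 := by
    have : Xᴴ * (X * Xᴴ) * W = 0 := by
      rw [hX1, Matrix.mul_assoc, Matrix.sub_mul, Matrix.mul_assoc, hW]; simp
    rwa [← Matrix.mul_assoc, hX, Matrix.one_mul] at this
  have hXE (f) : Xᴴ * E f * W = 0 := by
    rw [Matrix.mul_assoc, hW', ← Matrix.mul_assoc, hXW, Matrix.zero_mul]
  -- The complement is invariant because `(E f)ᴴ` is a multiple of `E f⁻¹`, which preserves `S`.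
  have hWE (f) : Wᴴ * E f * X = 0 := by
    have h1 : Xᴴ * (E f)ᴴ * W = 0 := by
      rw [hE.conjTranspose_eq hγ, Matrix.mul_smul, Matrix.smul_mul, hXE, smul_zero]
    simpa [Matrix.mul_assoc] using congrArg Matrix.conjTranspose h1
  have hX' (f) : E f * X = X * (Xᴴ * E f * X) := by
    have h1 : (W * Wᴴ + X * Xᴴ) * (E f * X) = E f * X := by rw [hWX, Matrix.one_mul]
    rw [Matrix.add_mul, Matrix.mul_assoc W, ← Matrix.mul_assoc Wᴴ, hWE, Matrix.mul_zero,
      zero_add] at h1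
    rw [← h1]; simp only [Matrix.mul_assoc]
  have hdim : p + q = k := by
    have := congrArg Matrix.trace hWX
    rw [Matrix.trace_add, Matrix.trace_mul_comm, hW, Matrix.trace_mul_comm X, hX] at this
    simp only [Matrix.trace_one, Fintype.card_fin] at this
    exact_mod_cast this
  have hp : p ≠ 0 := by
    rintro rfl
    refine hbot ((Submodule.eq_bot_iff _).2 fun v hv => ?_)
    rw [← (hmem v).1 hv, Subsingleton.elim (Wᴴ *ᵥ v) 0, Matrix.mulVec_zero]
  have hq : q ≠ 0 := by
    rintro rfl
    refine htop (Submodule.eq_top_iff'.2 fun v => (hmem v).2 ?_)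
    have : X * Xᴴ = 0 := by rw [Subsingleton.elim X 0, Matrix.zero_mul]
    rw [this, add_zero] at hWX
    rw [Matrix.mulVec_mulVec, hWX, Matrix.one_mulVec]
  have h1 := twistedSum_intertwines hW' (a := a)
  have h2 := twistedSum_intertwines hX' (a := a)
  rw [ih p (by omega) _ (hE.compress hW hW'), Matrix.mul_zero] at h1
  rw [ih q (by omega) _ (hE.compress hX hX'), Matrix.mul_zero] at h2
  rw [← Matrix.mul_one (twistedSum E a), ← hWX, Matrix.mul_add, ← Matrix.mul_assoc, h1,
    ← Matrix.mul_assoc, h2]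
  simp

end IsProjUnitaryRep

namespace IsCompleteIrreps

variable {G : Type*} [Group G] [Fintype G] {γ : G → G → ℂ} {κ : ℕ} {d : Fin κ → ℕ}
  {D : (l : Fin κ) → G → Matrix (Fin (d l)) (Fin (d l)) ℂ}

theorem twistedSum_eq_zero (hD : IsCompleteIrreps γ d D) (hγ : IsUnitaryFactorSystem γ)
    {a : G → ℂ} (ha : ∀ l, twistedSum (D l) a = 0) {n : Type*} [Fintype n] [DecidableEq n]
    {E : G → Matrix n n ℂ} (hE : IsProjUnitaryRep γ E) : twistedSum E a = 0 := by
  -- An orthonormal basis of the whole space makes `W` unitary and moves `E` to an index type `Fin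
  -- k`.
  obtain ⟨k, W, hW, hmem⟩ := exists_isometries_of_submodule (⊤ : Submodule ℂ (n → ℂ))
  have hWW : W * Wᴴ = 1 := by
    refine Matrix.ext_of_mulVec_single fun i => ?_
    rw [← Matrix.mulVec_mulVec, (hmem _).1 trivial, Matrix.one_mulVec]
  have h (f) : E f * W = W * (Wᴴ * E f * W) := by
    rw [Matrix.mul_assoc, ← Matrix.mul_assoc, hWW, Matrix.one_mul]
  have h1 := twistedSum_intertwines h (a := a)
  rw [IsProjUnitaryRep.twistedSum_eq_zero_of_dim hD hγ ha k _ (hE.compress hW h),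
    Matrix.mul_zero] at h1
  rw [← Matrix.mul_one (twistedSum E a), ← hWW, ← Matrix.mul_assoc, h1, Matrix.zero_mul]

theorem eq_of_twistedSum_eq [DecidableEq G] (hD : IsCompleteIrreps γ d D)
    (hγ : IsUnitaryFactorSystem γ) {a b : G → ℂ}
    (h : ∀ l, twistedSum (D l) a = twistedSum (D l) b) : a = b := by
  apply hγ.twistedSum_regularRep_injective
  rw [← sub_eq_zero, ← map_sub]
  exact hD.twistedSum_eq_zero hγ (fun l => by rw [map_sub, h, sub_self])
    hγ.regularRep_isProjUnitaryRep

end IsCompleteIrreps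

/-! ### Schur's lemma, orthogonality relations and Fourier inversion -/

/-- The kernel and the range of an intertwiner are invariant subspaces. -/
theorem IsIrredFamily.eq_zero_or_invertible {G m n : Type*} [Fintype m] [DecidableEq m]
    [Fintype n] [DecidableEq n] {D : G → Matrix m m ℂ} {E : G → Matrix n n ℂ}
    (hD : IsIrredFamily D) (hE : IsIrredFamily E) {T : Matrix m n ℂ}
    (hT : ∀ f, T * E f = D f * T) : T = 0 ∨ ∃ S : Matrix n m ℂ, T * S = 1 ∧ S * T = 1 := by
  rcases hE.2 (LinearMap.ker T.mulVecLin) (fun f v hv => by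
    simp only [LinearMap.mem_ker, Matrix.mulVecLin_apply] at hv ⊢
    rw [Matrix.mulVec_mulVec, hT, ← Matrix.mulVec_mulVec, hv, Matrix.mulVec_zero]) with hk | hk
  · rcases hD.2 (LinearMap.range T.mulVecLin) (by
      rintro f _ ⟨w, rfl⟩
      exact ⟨E f *ᵥ w, by simp [hT]⟩) with hr | hr
    · left
      refine Matrix.ext_of_mulVec_single fun i => ?_
      have : T.mulVecLin = 0 := LinearMap.range_eq_bot.1 hr
      rw [Matrix.zero_mulVec, ← Matrix.mulVecLin_apply, this, LinearMap.zero_apply]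
    · right
      let e := LinearEquiv.ofBijective T.mulVecLin
        ⟨LinearMap.ker_eq_bot.1 hk, LinearMap.range_eq_top.1 hr⟩
      have he : T = LinearMap.toMatrix' e.toLinearMap :=
        (LinearMap.toMatrix'_toLin' T).symm
      refine ⟨LinearMap.toMatrix' e.symm.toLinearMap, ?_, ?_⟩
      · rw [he, ← LinearMap.toMatrix'_comp, LinearEquiv.comp_symm, LinearMap.toMatrix'_id]
      · rw [he, ← LinearMap.toMatrix'_comp, LinearEquiv.symm_comp, LinearMap.toMatrix'_id]
  · left
    refine Matrix.ext_of_mulVec_single fun i => ?_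
    have : T.mulVecLin = 0 := LinearMap.ker_eq_top.1 hk
    rw [Matrix.zero_mulVec, ← Matrix.mulVecLin_apply, this, LinearMap.zero_apply]

theorem IsIrredFamily.exists_eq_smul_one {G n : Type*} [Fintype n] [DecidableEq n]
    {E : G → Matrix n n ℂ} (hE : IsIrredFamily E) {T : Matrix n n ℂ}
    (hT : ∀ f, T * E f = E f * T) : ∃ μ : ℂ, T = μ • 1 := by
  have := hE.1
  obtain ⟨μ, hμ⟩ := Module.End.exists_eigenvalue T.mulVecLin
  obtain ⟨v, hv, hv0⟩ := hμ.exists_hasEigenvector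
  rw [Module.End.mem_eigenspace_iff, Matrix.mulVecLin_apply] at hv
  refine ⟨μ, sub_eq_zero.1 ((hE.eq_zero_or_invertible hE (T := T - μ • 1) fun f => by
    simp [Matrix.sub_mul, Matrix.mul_sub, hT]).resolve_right ?_)⟩
  rintro ⟨S, -, hS⟩
  apply hv0
  rw [← Matrix.one_mulVec v, ← hS, ← Matrix.mulVec_mulVec, Matrix.sub_mulVec, hv,
    Matrix.smul_mulVec, Matrix.one_mulVec, sub_self, Matrix.mulVec_zero]

/-- The average of a matrix over the group, up to normalization. -/
def groupAverage {G m n : Type*} [Fintype G] [Fintype m] [Fintype n] (D : G → Matrix m m ℂ)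
    (E : G → Matrix n n ℂ) (X : Matrix m n ℂ) : Matrix m n ℂ :=
  ∑ f, D f * X * (E f)ᴴ

/-- Averaging a matrix unit produces the inner products of matrix coefficients, so Schur's lemma
becomes the orthogonality relations. -/
theorem groupAverage_single {G m n : Type*} [Fintype G] [Fintype m] [Fintype n] [DecidableEq m]
    [DecidableEq n] (D : G → Matrix m m ℂ) (E : G → Matrix n n ℂ) (i j : m) (k l : n) :
    groupAverage D E (Matrix.single j l 1) i k = ∑ f, D f i j * star (E f k l) := by
  simp only [groupAverage, Matrix.sum_apply]
  refine Finset.sum_congr rfl fun f _ => ?_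
  simp [Matrix.mul_apply, Matrix.single_apply, ite_and]

namespace IsProjUnitaryRep

variable {G m n : Type*} [Group G] [Fintype G] [Fintype m] [DecidableEq m] [Fintype n]
  [DecidableEq n] {γ : G → G → ℂ} {D : G → Matrix m m ℂ} {E : G → Matrix n n ℂ}

/-- After the shift `f ↦ g * f`, both sides acquire the same factor `γ g f`. -/
theorem groupAverage_intertwines (hγ : IsUnitaryFactorSystem γ) (hD : IsProjUnitaryRep γ D)
    (hE : IsProjUnitaryRep γ E) (X : Matrix m n ℂ) (g : G) :
    groupAverage D E X * E g = D g * groupAverage D E X := by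
  simp only [groupAverage, Matrix.sum_mul, Matrix.mul_sum]
  refine (Fintype.sum_equiv (Equiv.mulLeft g) _ _ fun f => ?_).symm
  have h : (E (g * f))ᴴ * E g = γ g f • (E f)ᴴ := by
    simpa using congrArg Matrix.conjTranspose (hE.conjTranspose_mul hγ g f)
  rw [Equiv.coe_mulLeft, Matrix.mul_assoc _ _ (E g), h, ← Matrix.mul_assoc, ← Matrix.mul_assoc,
    hD.mul]
  simp

theorem groupAverage_eq_smul_one (hγ : IsUnitaryFactorSystem γ) (hD : IsProjUnitaryRep γ D)
    (hirr : IsIrredFamily D) (X : Matrix m m ℂ) :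
    groupAverage D D X = ((Fintype.card G : ℂ) * X.trace / Fintype.card m) • 1 := by
  have := hirr.1
  obtain ⟨μ, hμ⟩ := hirr.exists_eq_smul_one (hD.groupAverage_intertwines hγ hD X)
  -- The trace determines the scalar given by Schur's lemma.
  have htr : (groupAverage D D X).trace = Fintype.card G * X.trace := by
    simp only [groupAverage, Matrix.trace_sum]
    simp [Matrix.trace_mul_comm _ (D _)ᴴ, ← Matrix.mul_assoc, hD.conjTranspose_mul_self]
  rw [hμ, Matrix.trace_smul, Matrix.trace_one, smul_eq_mul] at htr
  rw [hμ, ← htr, mul_div_cancel_right₀ _ (by simp)]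

end IsProjUnitaryRep

namespace IsCompleteIrreps

variable {G : Type*} [Group G] [Fintype G] {γ : G → G → ℂ} {κ : ℕ} {d : Fin κ → ℕ}
  {D : (l : Fin κ) → G → Matrix (Fin (d l)) (Fin (d l)) ℂ}

theorem groupAverage_eq_zero (hD : IsCompleteIrreps γ d D) (hγ : IsUnitaryFactorSystem γ)
    {l l' : Fin κ} (hl : l ≠ l') (X : Matrix (Fin (d l)) (Fin (d l')) ℂ) :
    groupAverage (D l) (D l') X = 0 := by
  have h := (hD.rep l).groupAverage_intertwines hγ (hD.rep l') X
  refine ((hD.irreducible l).eq_zero_or_invertible (hD.irreducible l') h).resolve_right ?_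
  rintro ⟨S, h1, h2⟩
  exact hD.inequivalent l l' hl ⟨_, S, h1, h2, h⟩

/-- The inverse group Fourier transform. -/
def inverseFourier (D : (l : Fin κ) → G → Matrix (Fin (d l)) (Fin (d l)) ℂ)
    (R : (l : Fin κ) → Matrix (Fin (d l)) (Fin (d l)) ℂ) (f : G) : ℂ :=
  ∑ l, ((d l : ℂ) / (Fintype.card G : ℂ)) * ∑ j, ∑ k, star (D l f j k) * R l j k

theorem twistedSum_inverseFourier (hD : IsCompleteIrreps γ d D) (hγ : IsUnitaryFactorSystem γ)
    (R : (l : Fin κ) → Matrix (Fin (d l)) (Fin (d l)) ℂ) (l : Fin κ) :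
    twistedSum (D l) (inverseFourier D R) = R l := by
  have := (hD.irreducible l).1
  have hd : (d l : ℂ) ≠ 0 := by
    have : Fintype.card (Fin (d l)) ≠ 0 := Fintype.card_ne_zero
    simpa using this
  ext p q
  have key : twistedSum (D l) (inverseFourier D R) p q =
      ∑ l', ((d l' : ℂ) / (Fintype.card G : ℂ)) * ∑ j, ∑ k,
        groupAverage (D l) (D l') (Matrix.single q k 1) p j * R l' j k := by
    simp only [groupAverage_single, twistedSum_apply, Matrix.sum_apply, Matrix.smul_apply,
      inverseFourier, smul_eq_mul, Finset.sum_mul, Finset.mul_sum]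
    rw [Finset.sum_comm]
    refine Finset.sum_congr rfl fun l' _ => ?_
    rw [Finset.sum_comm]
    refine Finset.sum_congr rfl fun j _ => ?_
    rw [Finset.sum_comm]
    refine Finset.sum_congr rfl fun k _ => Finset.sum_congr rfl fun f _ => ?_
    ring
  rw [key, Finset.sum_eq_single l]
  · simp only [(hD.rep l).groupAverage_eq_smul_one hγ (hD.irreducible l), Matrix.smul_apply,
      Matrix.one_apply, Fintype.card_fin]
    -- The identity matrix forces `j = p`, the trace of the matrix unit forces `k = q`, and the
    -- remaining factor `N / d l` cancels `d l / N`.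
    rw [Finset.sum_eq_single p, Finset.sum_eq_single q]
    · simp
      field_simp
    · intro k _ hk
      simp [Matrix.trace_single_eq_of_ne _ _ _ hk.symm]
    · simp
    · intro j _ hj
      simp [hj.symm]
    · simp
  · intro l' _ hl'
    simp [hD.groupAverage_eq_zero hγ hl'.symm]
  · simp

theorem isFourierOfUnitaries_iff [DecidableEq G] (hD : IsCompleteIrreps γ d D)
    (hγ : IsUnitaryFactorSystem γ) (c : G → ℂ) :
    IsFourierOfUnitaries d D c ↔ SatisfiesOrthogonality γ c := by
  have hiff : SatisfiesOrthogonality γ c ↔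
      ∀ l, twistedSum (D l) c ∈ Matrix.unitaryGroup (Fin (d l)) ℂ := by
    rw [satisfiesOrthogonality_iff]
    simp only [(hD.rep _).twistedSum_mem_unitaryGroup_iff hγ]
    exact ⟨fun h l => by rw [h], hD.eq_of_twistedSum_eq hγ⟩
  rw [hiff]
  constructor
  · rintro ⟨R, hR, hc⟩ l
    rw [show c = inverseFourier D R from funext hc, hD.twistedSum_inverseFourier hγ]
    exact hR l
  · intro h
    -- The unitaries are forced: `R l` is the image of `c` under `D l`.
    refine ⟨_, h, fun f => ?_⟩
    exact congrFun (hD.eq_of_twistedSum_eq hγ (b := inverseFourier D fun l => twistedSum (D l) c)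
      fun l => (hD.twistedSum_inverseFourier hγ (fun l => twistedSum (D l) c) l).symm) f

end IsCompleteIrreps

/-! ### Kernel of a representation and lifting of unitaries -/

namespace IsUnitaryFactorSystem

variable {G : Type*} [Group G] [Fintype G] [DecidableEq G] {γ : G → G → ℂ}

/-- Every row contributes the same inner product. This identifies the standard inner product with a
trace, so that left multiplication by `k*` is adjoint to left multiplication by `k`. -/
theorem trace_conjTranspose_mul_regularRep (hγ : IsUnitaryFactorSystem γ) (a b : G → ℂ) :
    ((twistedSum (regularRep γ) a)ᴴ * twistedSum (regularRep γ) b).trace =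
      Fintype.card G * (star a ⬝ᵥ b) := by
  rw [← groupCirculant_eq_twistedSum, ← groupCirculant_eq_twistedSum]
  have h (f : G) : ∑ g, star (groupCirculant γ a f g) * groupCirculant γ b f g = star a ⬝ᵥ b := by
    refine (Fintype.sum_equiv (Equiv.mulLeft f) _ _ fun g => ?_).symm
    simp only [groupCirculant, Matrix.of_apply, Equiv.coe_mulLeft, inv_mul_cancel_left, star_mul',
      Pi.star_apply]
    linear_combination -(star (a g) * b g) * hγ.star_mul f g
  simp only [Matrix.trace, Matrix.diag, Matrix.mul_apply, Matrix.conjTranspose_apply]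
  rw [Finset.sum_comm, Finset.sum_congr rfl fun f _ => h f]
  simp

end IsUnitaryFactorSystem

namespace IsProjUnitaryRep

variable {G n : Type*} [Group G] [Fintype G] [DecidableEq G] [Fintype n] [DecidableEq n]
  {γ : G → G → ℂ} {E : G → Matrix n n ℂ}

open scoped ComplexOrder in
/-- The kernel of a projective representation of the twisted group algebra is generated by a
central projection. -/
theorem exists_kernel_unit (hγ : IsUnitaryFactorSystem γ) (hE : IsProjUnitaryRep γ E) :
    ∃ p : G → ℂ, twistedSum E p = 0 ∧
      (twistedSum (regularRep γ) p)ᴴ = twistedSum (regularRep γ) p ∧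
      ∀ k, twistedSum E k = 0 →
        twistedSum (regularRep γ) k * twistedSum (regularRep γ) p = twistedSum (regularRep γ) k ∧
        twistedSum (regularRep γ) p * twistedSum (regularRep γ) k =
          twistedSum (regularRep γ) k := by
  have hR := hγ.regularRep_isProjUnitaryRep
  obtain ⟨m, W, hW, hmem⟩ := exists_isometries_of_submodule (LinearMap.ker (twistedSum E))
  simp only [LinearMap.mem_ker] at hmem
  set δ : G → ℂ := Pi.single 1 1
  -- The orthogonal projection of the unit `δ` onto the kernel.
  set p : G → ℂ := W *ᵥ (Wᴴ *ᵥ δ) with hp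
  have hEp : twistedSum E p = 0 := by
    rw [hmem, hp, Matrix.mulVec_mulVec _ Wᴴ W, hW, Matrix.one_mulVec]
  have horth (k) (hk : twistedSum E k = 0) : star k ⬝ᵥ (δ - p) = 0 := by
    rw [← (hmem k).1 hk, Matrix.star_mulVec, ← Matrix.dotProduct_mulVec, Matrix.mulVec_sub, hp,
      Matrix.mulVec_mulVec _ Wᴴ W, hW, Matrix.one_mulVec, sub_self, dotProduct_zero]
  have hright (k) (hk : twistedSum E k = 0) :
      twistedSum (regularRep γ) k * twistedSum (regularRep γ) (δ - p) = 0 := by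
    rw [← hR.twistedSum_conv]
    -- For `x = k(δ - p)`, the inner product `⟨x, x⟩` equals `⟨k* x, δ - p⟩`, which vanishes because
    -- `k* x` is in the kernel and `δ - p` is orthogonal to it.
    obtain ⟨x, hx⟩ : ∃ x, x = twistedConv γ k (δ - p) := ⟨_, rfl⟩
    have hEx : twistedSum E x = 0 := by rw [hx, hE.twistedSum_conv, hk, Matrix.zero_mul]
    rw [← hx, ← Matrix.trace_conjTranspose_mul_self_eq_zero_iff]
    nth_rw 2 [hx]
    rw [hR.twistedSum_conv, ← Matrix.mul_assoc]
    have : (twistedSum (regularRep γ) x)ᴴ * twistedSum (regularRep γ) k =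
        (twistedSum (regularRep γ) (twistedConv γ (twistedStar γ k) x))ᴴ := by
      rw [hR.twistedSum_conv, hR.twistedSum_star hγ, Matrix.conjTranspose_mul,
        Matrix.conjTranspose_conjTranspose]
    rw [this, hγ.trace_conjTranspose_mul_regularRep, horth, mul_zero]
    rw [hE.twistedSum_conv, hEx, Matrix.mul_zero]
  have hright' (k) (hk : twistedSum E k = 0) :
      twistedSum (regularRep γ) k * twistedSum (regularRep γ) p = twistedSum (regularRep γ) k := by
    have := hright k hk
    rw [map_sub, hR.twistedSum_single, Matrix.mul_sub, Matrix.mul_one, sub_eq_zero] at this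
    exact this.symm
  have hstar (k) (hk : twistedSum E k = 0) : twistedSum E (twistedStar γ k) = 0 := by
    rw [hE.twistedSum_star hγ, hk, Matrix.conjTranspose_zero]
  have hsa : (twistedSum (regularRep γ) p)ᴴ = twistedSum (regularRep γ) p := by
    -- From `p* p = p*` and its adjoint `p* p = p`, the element `p` is self-adjoint.
    have h1 := hright' _ (hstar p hEp)
    rw [hR.twistedSum_star hγ] at h1
    have h2 := congrArg Matrix.conjTranspose h1
    rw [Matrix.conjTranspose_mul, Matrix.conjTranspose_conjTranspose] at h2
    rw [← h1, h2]
  refine ⟨p, hEp, hsa, fun k hk => ⟨hright' k hk, ?_⟩⟩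
  have h1 := congrArg Matrix.conjTranspose (hright' _ (hstar k hk))
  rwa [hR.twistedSum_star hγ, Matrix.conjTranspose_mul, Matrix.conjTranspose_conjTranspose,
    hsa] at h1

/-- A unitary in the image of the twisted group algebra lifts to a unitary of the algebra. -/
theorem exists_unitary_lift (hγ : IsUnitaryFactorSystem γ) (hE : IsProjUnitaryRep γ E)
    {c : G → ℂ} (hc : twistedSum E c ∈ Matrix.unitaryGroup n ℂ) :
    ∃ c' : G → ℂ, twistedSum E c' = twistedSum E c ∧ SatisfiesOrthogonality γ c' := by
  have hR := hγ.regularRep_isProjUnitaryRep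
  obtain ⟨p, hEp, hsa, hker⟩ := hE.exists_kernel_unit hγ
  -- Keep `c` on the complement of the kernel, where it is unitary, and replace it by the unit `p`
  -- on the kernel.
  refine ⟨c - twistedConv γ p c + p, ?_, ?_⟩
  · rw [map_add, map_sub, hE.twistedSum_conv, hEp, Matrix.zero_mul, sub_zero, add_zero]
  rw [← hγ.groupCirculant_mem_unitaryGroup_iff, groupCirculant_eq_twistedSum,
    Matrix.mem_unitaryGroup_iff', map_add, map_sub, hR.twistedSum_conv,
    Matrix.star_eq_conjTranspose]
  have hpp := (hker p hEp).1
  have h1 := (hker (autocorrelation γ c - Pi.single 1 1) (by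
    rw [map_sub, sub_eq_zero]; exact (hE.twistedSum_mem_unitaryGroup_iff hγ c).1 hc)).1
  rw [map_sub, hR.twistedSum_autocorrelation hγ, hR.twistedSum_single] at h1
  have h2 := (hker (twistedConv γ p c) (by
    rw [hE.twistedSum_conv, hEp, Matrix.zero_mul])).1
  have h3 := (hker (twistedConv γ c p) (by
    rw [hE.twistedSum_conv, hEp, Matrix.mul_zero])).2
  rw [hR.twistedSum_conv] at h2 h3
  generalize twistedSum (regularRep γ) p = P at *
  generalize twistedSum (regularRep γ) c = X at *
  -- Both products lie in the ideal for which `P` is a two-sided unit, so both equal `P * X * P`.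
  have hcomm : P * X = X * P := by rw [← h2, ← h3, Matrix.mul_assoc]
  rw [Matrix.conjTranspose_add, Matrix.conjTranspose_sub, Matrix.conjTranspose_mul, hsa]
  have hcomm' : P * Xᴴ = Xᴴ * P := by
    simpa [hsa] using (congrArg Matrix.conjTranspose hcomm).symm
  have h4 : Xᴴ * (P * X) = Xᴴ * X - 1 + P := by
    rw [hcomm, ← Matrix.mul_assoc, ← sub_eq_iff_eq_add]
    rw [Matrix.sub_mul, Matrix.one_mul] at h1
    exact h1
  have h5 : P * (P * X) = P * X := by rw [← Matrix.mul_assoc, hpp]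
  simp only [Matrix.add_mul, Matrix.sub_mul, Matrix.mul_add, Matrix.mul_sub, Matrix.mul_assoc, h5,
    hpp, h4]
  abel

end IsProjUnitaryRep

/-! ### The protocol -/

namespace Gates

variable {G A B : Type*} [Fintype G] [DecidableEq G] [Fintype A] [DecidableEq A]
  [Fintype B] [DecidableEq B]

/-- The component of a state of the whole system along `|a⟩|b⟩`. -/
def component (a b : G) (φ : (G × A) × (G × B) → ℂ) : A × B → ℂ :=
  fun x => φ ((a, x.1), (b, x.2))

omit [DecidableEq A] in
theorem component_alice_controlled (W : G → Matrix A A ℂ) (φ : (G × A) × (G × B) → ℂ) (a b : G) :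
    component a b (alice (controlled W) *ᵥ φ) =
      (W a ⊗ₖ (1 : Matrix B B ℂ)) *ᵥ component a b φ := by
  ext ⟨i, j⟩
  simp [component, alice, controlled, Matrix.mulVec, dotProduct, Fintype.sum_prod_type,
    Matrix.sum_apply, Matrix.single_apply, Matrix.one_apply, ite_and]

theorem component_alice_ancilla (M : Matrix G G ℂ) (φ : (G × A) × (G × B) → ℂ) (a b : G) :
    component a b (alice (M ⊗ₖ (1 : Matrix A A ℂ)) *ᵥ φ) =
      ∑ a', M a a' • component a' b φ := by
  ext ⟨i, j⟩
  simp [component, alice, Matrix.mulVec, dotProduct, Fintype.sum_prod_type, Matrix.one_apply]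

omit [DecidableEq A] in
theorem component_alice_system (X : Matrix A A ℂ) (φ : (G × A) × (G × B) → ℂ) (a b : G) :
    component a b (alice ((1 : Matrix G G ℂ) ⊗ₖ X) *ᵥ φ) =
      (X ⊗ₖ (1 : Matrix B B ℂ)) *ᵥ component a b φ := by
  ext ⟨i, j⟩
  simp [component, alice, Matrix.mulVec, dotProduct, Fintype.sum_prod_type, Matrix.one_apply]

omit [DecidableEq B] in
theorem component_bob_controlled (W : G → Matrix B B ℂ) (φ : (G × A) × (G × B) → ℂ) (a b : G) :
    component a b (bob (controlled W) *ᵥ φ) =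
      ((1 : Matrix A A ℂ) ⊗ₖ W b) *ᵥ component a b φ := by
  ext ⟨i, j⟩
  simp [component, bob, controlled, Matrix.mulVec, dotProduct, Fintype.sum_prod_type,
    Matrix.sum_apply, Matrix.single_apply, Matrix.one_apply, ite_and]

theorem component_bob_ancilla (M : Matrix G G ℂ) (φ : (G × A) × (G × B) → ℂ) (a b : G) :
    component a b (bob (M ⊗ₖ (1 : Matrix B B ℂ)) *ᵥ φ) =
      ∑ b', M b b' • component a b' φ := by
  ext ⟨i, j⟩
  simp [component, bob, Matrix.mulVec, dotProduct, Fintype.sum_prod_type, Matrix.one_apply]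

omit [Fintype A] [DecidableEq A] [Fintype B] [DecidableEq B] in
theorem component_initialState (ψ : A × B → ℂ) (a b : G) :
    component a b (initialState ψ) =
      if a = b then (((Real.sqrt (Fintype.card G))⁻¹ : ℝ) : ℂ) • ψ else 0 := by
  ext x
  by_cases h : a = b <;> simp [component, initialState, h]

/-- The shared entangled state transfers the control of `U` from `a` to `b`; the measurement of `a`
leaves only the weight `F h b`. -/
theorem component_afterAlice (P : Gates G A B) (h : G) (ψ : A × B → ℂ) (a b : G) :
    component a b (P.afterAlice h ψ) =
      if a = h then (P.F h b * (((Real.sqrt (Fintype.card G))⁻¹ : ℝ) : ℂ)) •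
        ((P.U b ⊗ₖ (1 : Matrix B B ℂ)) *ᵥ ψ) else 0 := by
  simp only [afterAlice, component_alice_ancilla, component_alice_controlled,
    component_initialState]
  by_cases ha : a = h
  · subst ha
    rw [Finset.sum_eq_single a, Finset.sum_eq_single b]
    · simp [Matrix.mulVec_smul, smul_smul]
    · intro a' _ ha'
      simp [ha']
    · simp
    · intro a' _ ha'
      simp [ha'.symm]
    · simp
  · simp [ha, Ne.symm ha]

theorem component_finalState (P : Gates G A B) {z : ℂ} (h g : G)
    (hZ : P.Z h = phaseGate P.F z h) (hF : ∀ f, P.F h f ≠ 0) (ψ : A × B → ℂ) (a b : G) :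
    component a b (P.finalState h g ψ) =
      if a = h ∧ b = g then (z * (((Real.sqrt (Fintype.card G))⁻¹ : ℝ) : ℂ)) •
        ((P.U g ⊗ₖ P.V g)ᴴ * ∑ f, P.C g f • (P.U f ⊗ₖ P.V f)) *ᵥ ψ else 0 := by
  simp only [finalState, afterBob, component_alice_system, component_bob_ancilla,
    component_bob_controlled, component_afterAlice]
  by_cases ha : a = h
  swap
  · simp [ha]
  by_cases hb : b = g
  swap
  · simp [hb, Ne.symm hb]
  subst ha hb
  rw [Finset.sum_eq_single b]
  · have hsum (f) : ∑ b', P.Z a f b' •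
        (P.F a b' * (((Real.sqrt (Fintype.card G))⁻¹ : ℝ) : ℂ)) •
          ((P.U b' ⊗ₖ (1 : Matrix B B ℂ)) *ᵥ ψ) =
        (z * (((Real.sqrt (Fintype.card G))⁻¹ : ℝ) : ℂ)) •
          ((P.U f ⊗ₖ (1 : Matrix B B ℂ)) *ᵥ ψ) := by
      rw [Finset.sum_eq_single f]
      · rw [hZ, phaseGate, Matrix.diagonal_apply_eq, smul_smul]
        congr 1
        have := hF f
        field_simp
      · intro b' _ hb'
        simp [hZ, phaseGate, Matrix.diagonal_apply_ne _ hb'.symm]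
      · simp
    simp only [if_true, hsum]
    simp only [Matrix.single_apply_same, one_smul, and_self, if_true, Matrix.mulVec_smul,
      Matrix.mulVec_mulVec, smul_comm (P.C b _), ← Finset.smul_sum, Matrix.mulVec_sum,
      Matrix.mul_sum, Matrix.sum_mulVec, Matrix.mul_smul, Matrix.smul_mulVec,
      Matrix.conjTranspose_kronecker, ← Matrix.mul_kronecker_mul, Matrix.one_mul, Matrix.mul_one]
  · intro b' _ hb'
    simp [hb'.symm]
  · simp

end Gates

/-- With `f = g * k`, the factor `γ g k` in the matrix entry cancels the `star (γ g k)` from `(E g)ᴴ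
* E (g * k)`, so the result does not depend on `g`. -/
theorem groupCirculant_row_sum {G n : Type*} [Group G] [Fintype G] [Fintype n] [DecidableEq n]
    {γ : G → G → ℂ} (hγ : IsUnitaryFactorSystem γ) {E : G → Matrix n n ℂ}
    (hE : IsProjUnitaryRep γ E) (c : G → ℂ) (g : G) :
    (E g)ᴴ * ∑ f, groupCirculant γ c g f • E f = twistedSum E c := by
  rw [twistedSum_apply, Matrix.mul_sum]
  refine (Fintype.sum_equiv (Equiv.mulLeft g) _ _ fun k => ?_).symm
  simp only [groupCirculant, Matrix.of_apply, Equiv.coe_mulLeft, inv_mul_cancel_left,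
    Matrix.mul_smul, hE.conjTranspose_mul hγ, smul_smul]
  congr 1
  linear_combination -(c k) * hγ.star_mul g k

theorem Gates.carriesOut_doubleUnitary {G A B : Type*} [Group G] [Fintype G] [DecidableEq G]
    [Fintype A] [DecidableEq A] [Fintype B] [DecidableEq B]
    {γ : G → G → ℂ} (hγ : IsUnitaryFactorSystem γ) {U : G → Matrix A A ℂ} {V : G → Matrix B B ℂ}
    (hU : ∀ f, U f ∈ Matrix.unitaryGroup A ℂ) (hV : ∀ f, V f ∈ Matrix.unitaryGroup B ℂ)
    (hUV : IsProjUnitaryRep γ (fun f => U f ⊗ₖ V f)) {c : G → ℂ}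
    (hC : groupCirculant γ c ∈ Matrix.unitaryGroup G ℂ) {F : Matrix G G ℂ} {z : ℂ}
    (hF : IsUnbiased F) (hz : ‖z‖ = (Real.sqrt (Fintype.card G))⁻¹) :
    Gates.CarriesOut
      { U := U, V := V, F := F, Z := phaseGate F z, C := groupCirculant γ c }
      (doubleUnitary c U V) := by
  have hN : (0 : ℝ) < Real.sqrt (Fintype.card G) := by
    rw [Real.sqrt_pos]; exact_mod_cast Fintype.card_pos
  have hF0 (h f) : F h f ≠ 0 := by
    rw [← norm_pos_iff, hF.2]; positivity
  refine ⟨⟨hU, hV, hF.1, fun h => ?_, hC⟩,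
    fun _ _ => z * (((Real.sqrt (Fintype.card G))⁻¹ : ℝ) : ℂ), ?_, fun h g ψ => ?_⟩
  · change phaseGate F z h ∈ _
    rw [Matrix.mem_unitaryGroup_iff', phaseGate, Matrix.star_eq_conjTranspose,
      Matrix.diagonal_conjTranspose, Matrix.diagonal_mul_diagonal, ← Matrix.diagonal_one]
    congr 1
    ext f
    rw [Pi.star_apply, ← starRingEnd_apply, RCLike.conj_mul]
    simp [hz, hF.2, hN.ne']
  -- Each of the `N²` outcomes has probability `1 / N²`.
  · simp [hz, mul_pow, Real.sq_sqrt]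
  · ext ⟨⟨a, i⟩, ⟨b, j⟩⟩
    have := congrFun (Gates.component_finalState
      { U := U, V := V, F := F, Z := phaseGate F z, C := groupCirculant γ c } h g rfl (hF0 h)
      ψ a b) (i, j)
    rw [groupCirculant_row_sum hγ hUV, ← doubleUnitary_eq_twistedSum] at this
    refine this.trans ?_
    by_cases hab : a = h ∧ b = g <;> simp [Gates.outputState, hab]

end

theorem theorem7 {G A B : Type*} [Group G] [Fintype G] [DecidableEq G]
    [Fintype A] [DecidableEq A] [Nonempty A] [Fintype B] [DecidableEq B] [Nonempty B]
    (γ : G → G → ℂ) (U : G → Matrix A A ℂ) (V : G → Matrix B B ℂ)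
    (hU : ∀ f, U f ∈ Matrix.unitaryGroup A ℂ) (hV : ∀ f, V f ∈ Matrix.unitaryGroup B ℂ)
    (hUV : IsProjUnitaryRep γ (fun f => U f ⊗ₖ V f))
    {κ : ℕ} (d : Fin κ → ℕ) (D : (l : Fin κ) → G → Matrix (Fin (d l)) (Fin (d l)) ℂ)
    (hD : IsCompleteIrreps γ d D) (c : G → ℂ) :
    -- (a)
    [groupCirculant γ c ∈ Matrix.unitaryGroup G ℂ,
      IsFourierOfUnitaries d D c,
      SatisfiesOrthogonality γ c].TFAE ∧
    -- (b)
    ((groupCirculant γ c ∈ Matrix.unitaryGroup G ℂ ∨ IsFourierOfUnitaries d D c ∨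
        SatisfiesOrthogonality γ c) →
      doubleUnitary c U V ∈ Matrix.unitaryGroup (A × B) ℂ ∧
      ∀ (F : Matrix G G ℂ) (z : ℂ), IsUnbiased F → ‖z‖ = (Real.sqrt (Fintype.card G))⁻¹ →
        Gates.CarriesOut
          { U := U, V := V, F := F, Z := phaseGate F z, C := groupCirculant γ c }
          (doubleUnitary c U V)) ∧
    -- (c)
    (doubleUnitary c U V ∈ Matrix.unitaryGroup (A × B) ℂ →
      LinearIndependent ℂ (fun f => U f ⊗ₖ V f) →
      groupCirculant γ c ∈ Matrix.unitaryGroup G ℂ ∧ IsFourierOfUnitaries d D c ∧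
        SatisfiesOrthogonality γ c) ∧
    -- (d)
    (doubleUnitary c U V ∈ Matrix.unitaryGroup (A × B) ℂ →
      ¬ LinearIndependent ℂ (fun f => U f ⊗ₖ V f) →
      (∃ c' : G → ℂ, c' ≠ c ∧ doubleUnitary c' U V = doubleUnitary c U V) ∧
      ∃ c' : G → ℂ, doubleUnitary c' U V = doubleUnitary c U V ∧
        groupCirculant γ c' ∈ Matrix.unitaryGroup G ℂ ∧ IsFourierOfUnitaries d D c' ∧
        SatisfiesOrthogonality γ c') := by
  have hγ := hUV.isUnitaryFactorSystem
  have hi (c : G → ℂ) := hγ.groupCirculant_mem_unitaryGroup_iff c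
  have hii (c : G → ℂ) := hD.isFourierOfUnitaries_iff hγ c
  have huni := hUV.twistedSum_mem_unitaryGroup_iff hγ c
  rw [← doubleUnitary_eq_twistedSum] at huni
  refine ⟨?_, fun h => ?_, fun hu hli => ?_, fun hu hli => ⟨?_, ?_⟩⟩
  · tfae_have 1 ↔ 3 := hi c
    tfae_have 2 ↔ 3 := hii c
    tfae_finish
  · rw [hi, hii, or_self, or_self] at h
    refine ⟨huni.2 (by rw [(satisfiesOrthogonality_iff γ c).1 h]), fun F z hF hz => ?_⟩
    exact Gates.carriesOut_doubleUnitary hγ hU hV hUV ((hi c).2 h) hF hz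
  · have h : SatisfiesOrthogonality γ c := by
      rw [satisfiesOrthogonality_iff, ← sub_eq_zero]
      have h0 := huni.1 hu
      rw [← sub_eq_zero, ← map_sub, twistedSum_apply] at h0
      exact funext (Fintype.linearIndependent_iff.1 hli _ h0)
    exact ⟨(hi c).2 h, (hii c).2 h, h⟩
  · obtain ⟨a, ha, i, hai⟩ := Fintype.not_linearIndependent_iff.1 hli
    -- Adding a nontrivial linear relation `a` changes the coefficients but not the operator.
    refine ⟨c + a, fun h => hai ?_, ?_⟩
    · exact congrFun (add_eq_left.1 h) i
    · rw [doubleUnitary_eq_twistedSum, doubleUnitary_eq_twistedSum, map_add,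
        twistedSum_apply _ a, ha, add_zero]
  · rw [doubleUnitary_eq_twistedSum] at hu
    obtain ⟨c', hc', h⟩ := hUV.exists_unitary_lift hγ hu
    refine ⟨c', ?_, (hi c').2 h, (hii c').2 h, h⟩
    rw [doubleUnitary_eq_twistedSum, doubleUnitary_eq_twistedSum, hc']
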